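/- Let $n_r\ge 1$ and $n_t\ge 2$, let $\mathbb{H}\in\mathbb{R}^{n_r\times n_t}$ be a matrix with nonnegative entries and of rank one, let $1\ge\alpha_1\ge\alpha_2\ge\cdots\ge\alpha_{n_t}\ge 0$, and let $\sigma>0$. Let $\mathsf{C}_{\mathrm E}(\mathbb{H},\boldsymbol\alpha,\sigma)$ be the capacity of the equal-cost constrained MIMO optical intensity channel (EC-OIC) $\mathbf{Y}=\mathbb{H}\mathbf{X}+\mathbf{Z}$ with $\mathbf{Z}\sim\mathcal N(\mathbf 0,\sigma^2\mathbb{I}_{n_r})$ independent of $\mathbf X$, that is, $$\mathsf{C}_{\mathrm E}(\mathbb{H},\boldsymbol\alpha,\sigma)=\sup_{\mathscr P_{\mathbf X}} I(\mathbf X;\mathbf Y),$$ where the supremum is over all probability laws of $\mathbf X=(X_1,\dots,X_{n_t})$ such that, for every $k\in\{1,\dots,n_t\}$, $X_k\ge 0$ almost surely, $\mathbb{P}\{X_k>1\}=0$ and $\mathbb{E}[X_k]=\alpha_k$. Let $\mathbb{H}=\mathbb{U}\mathbb{B}\mathbb{V}^{\mathsf T}$ be a singular value decomposition, let $\sigma_1>0$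 be the unique nonzero singular value of $\mathbb{H}$, and let $\mathbf v_1=(v_1^{(1)},\dots,v_1^{(n_t)})^{\mathsf T}$ be the first column of $\mathbb{V}$, with its sign chosen such that $\mathbf 1^{\mathsf T}\mathbf v_1=\sum_{i=1}^{n_t}v_1^{(i)}>0$. Then $$\mathsf{C}_{\mathrm E}(\mathbb{H},\boldsymbol\alpha,\sigma)=\sup_{\mathscr P_S} I\left(S;\,S+\frac{\widetilde Z}{\sigma_1(\mathbf 1^{\mathsf T}\mathbf v_1)}\right),$$ where $\widetilde Z\sim\mathcal N(0,\sigma^2)$ is independent of $S$, and the supremum is over all probability laws of a real random variable $S$ with $\operatorname{supp} S\subseteq[0,1]$, $$\mathbb{E}[S]=\frac{1}{\mathbf 1^{\mathsf T}\mathbf v_1}\sum_{i=1}^{n_t}v_1^{(i)}\alpha_i,$$ and $$\mathbb{E}\left[\left(S-\sum_{i=1}^{k}\frac{v_1^{(i)}}{\mathbf 1^{\mathsf T}\mathbf v_1}\right)_+\right]\le\frac{1}{\mathbf 1^{\mathsf T}\mathbf v_1}\sum_{i=k+1}^{n_t}v_1^{(i)}\alpha_i,\qquad k\in\{1,\dots,n_t-1\},$$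 where $(x)_+=\max\{x,0\}$. -/

import Mathlib

open MeasureTheory ProbabilityTheory Matrix
open scoped ENNReal

noncomputable section

/-- The mutual information `I(X; Y) = D(P_{(X,Y)} ‖ P_X ⊗ P_Y)` (in nats, with values in `[0, ∞]`)
of two random variables on the probability space `(Ω, μ)`. -/
def mutualInfo {Ω 𝓧 𝓨 : Type*} [MeasurableSpace Ω] [MeasurableSpace 𝓧] [MeasurableSpace 𝓨]
    (μ : Measure Ω) (X : Ω → 𝓧) (Y : Ω → 𝓨) : ℝ≥0∞ :=
  InformationTheory.klDiv (μ.map (fun ω => (X ω, Y ω))) ((μ.map X).prod (μ.map Y))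

/-- The law `N(0, σ² I_m)` of the additive white Gaussian noise vector. -/
def awgn (m : ℕ) (σ : ℝ) : Measure (EuclideanSpace ℝ (Fin m)) :=
  multivariateGaussian 0 (σ ^ 2 • (1 : Matrix (Fin m) (Fin m) ℝ))

/-- `P` is the law of an input vector `X` that is nonnegative, has `ℙ(X_k > 1) = 0`, and satisfies
`𝔼[X_k] = α_k` for every `k` (equal-cost constraints). -/
structure IsECInput {n : ℕ} (α : Fin n → ℝ) (P : Measure (Fin n → ℝ)) : Prop where
  isProbabilityMeasure : IsProbabilityMeasure P
  nonneg : ∀ᵐ x ∂P, ∀ k, 0 ≤ x k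
  peak : ∀ k, P {x | 1 < x k} = 0
  mean : ∀ k, ∫ x, x k ∂P = α k

/-- The capacity `C_E(H, α, σ) = sup I(X; Y)` of the channel `Y = H X + Z`, where
`Z ∼ N(0, σ² I)` is independent of `X` and the supremum is over all input laws that satisfy the
equal-cost constraints. The pair `(X, Z)` is realized as the identity on the product space. -/
def capacityEC {m n : ℕ} (H : Matrix (Fin m) (Fin n) ℝ) (α : Fin n → ℝ) (σ : ℝ) : ℝ≥0∞ :=
  ⨆ (P : Measure (Fin n → ℝ)) (_ : IsECInput α P),
    mutualInfo (P.prod (awgn m σ)) (fun ω => ω.1)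
      (fun ω => WithLp.toLp 2 (H *ᵥ ω.1) + ω.2)

/-- `H = U B Vᵀ` is a singular value decomposition: `U`, `V` are orthogonal, `B` vanishes off the
diagonal, its first `rank H` diagonal entries are positive and in descending order, and its other
diagonal entries are zero. -/
structure IsSVD {m n : ℕ} (H : Matrix (Fin m) (Fin n) ℝ) (U : Matrix (Fin m) (Fin m) ℝ)
    (B : Matrix (Fin m) (Fin n) ℝ) (V : Matrix (Fin n) (Fin n) ℝ) : Prop where
  left_orthogonal : U ∈ Matrix.orthogonalGroup (Fin m) ℝ
  right_orthogonal : V ∈ Matrix.orthogonalGroup (Fin n) ℝ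
  eq_mul : H = U * B * Vᵀ
  off_diagonal : ∀ (i : Fin m) (j : Fin n), (i : ℕ) ≠ (j : ℕ) → B i j = 0
  pos : ∀ (i : Fin m) (j : Fin n), (i : ℕ) = (j : ℕ) → (i : ℕ) < H.rank → 0 < B i j
  zero : ∀ (i : Fin m) (j : Fin n), (i : ℕ) = (j : ℕ) → H.rank ≤ (i : ℕ) → B i j = 0
  descending : ∀ (i i' : Fin m) (j j' : Fin n), (i : ℕ) = (j : ℕ) → (i' : ℕ) = (j' : ℕ) →
    i ≤ i' → B i' j' ≤ B i j

/-- `P` is the law of a scalar input `S` supported in `[0, 1]` that satisfies, for the weights `v`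
and the intensities `α` (indexed from `0`), the mean constraint
`𝔼[S] = (∑ i, v i * α i) / ∑ i, v i` and, for `k = 1, …, n - 1`, the stop-loss constraint
`𝔼[(S - ∑_{the first k indices} v i / ∑ j, v j)₊] ≤ (∑_{the other indices} v i * α i) / ∑ j, v j`. -/
structure IsStopLossInput {n : ℕ} (v α : Fin n → ℝ) (P : Measure ℝ) : Prop where
  isProbabilityMeasure : IsProbabilityMeasure P
  support : ∀ᵐ s ∂P, s ∈ Set.Icc (0 : ℝ) 1
  mean : ∫ s, s ∂P = (1 / (∑ i, v i)) * ∑ i, v i * α i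
  stopLoss : ∀ k : ℕ, 1 ≤ k → k < n →
    ∫ s, max (s -
        ∑ i ∈ Finset.univ.filter (fun i : Fin n => (i : ℕ) < k), v i / (∑ j, v j)) 0 ∂P
      ≤ (1 / (∑ i, v i)) * ∑ i ∈ Finset.univ.filter (fun i : Fin n => k ≤ (i : ℕ)), v i * α i

end

/-! A rank-one channel matrix is `σ₁ u vᵀ`, so the output depends on `X` only through the weighted
average S = vᵀX / 1ᵀv. Rotating the output by `Uᵀ` puts the signal into one coordinate; the others
are noise independent of the input and of that coordinate. Hence I(X; Y) is the mutual information
of a scalar channel with input S (`mutualInfo_rank_one`, via `mutualInfo_sufficient`).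

What remains is to identify the possible laws of S. Since each coordinate is at most 1, S exceeds
the total weight of the first k coordinates by at most the weighted tail, and taking expectations
makes the stop-loss constraints necessary. Conversely, split S greedily among the coordinates: the
stop-loss bounds say exactly that the resulting means dominate `α` in weighted partial sums.
Transfers between coordinates then bring the means to `α` without changing S or leaving [0, 1]
(`exists_eq_of_weighted_majorization`). -/

/-! ### Mutual information and sufficient statistics -/

section Information

variable {Ω Ω' 𝓧 𝓨 𝓧' 𝓨' 𝓢 𝓦 𝓝 𝓡 : Type*} [MeasurableSpace Ω] [MeasurableSpace Ω']
  [MeasurableSpace 𝓧] [MeasurableSpace 𝓨] [MeasurableSpace 𝓧'] [MeasurableSpace 𝓨']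
  [MeasurableSpace 𝓢] [MeasurableSpace 𝓦] [MeasurableSpace 𝓝] [MeasurableSpace 𝓡]

lemma mutualInfo_map {μ : Measure Ω} {T : Ω → Ω'} (hT : Measurable T) {X : Ω' → 𝓧} {Y : Ω' → 𝓨}
    (hX : Measurable X) (hY : Measurable Y) :
    mutualInfo (μ.map T) X Y = mutualInfo μ (fun ω => X (T ω)) (fun ω => Y (T ω)) := by
  unfold mutualInfo
  rw [Measure.map_map (hX.prodMk hY) hT, Measure.map_map hX hT, Measure.map_map hY hT]
  rfl

/-- **Data processing inequality** for the mutual information. -/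
lemma mutualInfo_comp_le {μ : Measure Ω} [IsFiniteMeasure μ] {X : Ω → 𝓧} {Y : Ω → 𝓨}
    (hX : Measurable X) (hY : Measurable Y) {f : 𝓧 → 𝓧'} {g : 𝓨 → 𝓨'}
    (hf : Measurable f) (hg : Measurable g) :
    mutualInfo μ (fun ω => f (X ω)) (fun ω => g (Y ω)) ≤ mutualInfo μ X Y := by
  have h := InformationTheory.klDiv_map_le (μ.map (fun ω => (X ω, Y ω)))
    ((μ.map X).prod (μ.map Y)) (hf.prodMap hg)
  rw [← Measure.map_prod_map _ _ hf hg, Measure.map_map hf hX, Measure.map_map hg hY,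
    Measure.map_map (hf.prodMap hg) (hX.prodMk hY)] at h
  exact h

lemma mutualInfo_comp_right_of_leftInverse {μ : Measure Ω} [IsFiniteMeasure μ] {X : Ω → 𝓧}
    {Y : Ω → 𝓨} (hX : Measurable X) (hY : Measurable Y) {g : 𝓨 → 𝓨'} {g' : 𝓨' → 𝓨}
    (hg : Measurable g) (hg' : Measurable g') (h : Function.LeftInverse g' g) :
    mutualInfo μ X (fun ω => g (Y ω)) = mutualInfo μ X Y := by
  refine le_antisymm (mutualInfo_comp_le hX hY measurable_id hg) ?_
  have := mutualInfo_comp_le (μ := μ) hX (hg.comp hY) measurable_id hg'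
  simpa only [Function.comp_def, h _, id] using this

/-- Resampling `X` from its conditional law given `f X` turns the joint law of `f X` and
`g (f X, W)` into that of `X` and `g (f X, W)`; the component of law `ρ` is independent of both. -/
lemma map_compProd_condDistrib [StandardBorelSpace 𝓧] [Nonempty 𝓧]
    (P : Measure 𝓧) [IsProbabilityMeasure P] (γ : Measure 𝓦) [IsProbabilityMeasure γ]
    (ρ : Measure 𝓝) [IsProbabilityMeasure ρ] {f : 𝓧 → 𝓢} (hf : Measurable f)
    {g : 𝓢 × 𝓦 → 𝓡} (hg : Measurable g) :
    ((((P.map f).prod γ).map (fun ω => (ω.1, g ω))) ⊗ₘ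
        (((condDistrib id f P).comap Prod.fst measurable_fst) ×ₖ Kernel.const _ ρ)).map
        (fun q : (𝓢 × 𝓡) × (𝓧 × 𝓝) => (q.2.1, (q.1.2, q.2.2))) =
      (P.prod (γ.prod ρ)).map (fun ω => (ω.1, (g (f ω.1, ω.2.1), ω.2.2))) := by
  have : IsProbabilityMeasure (P.map f) := Measure.isProbabilityMeasure_map hf.aemeasurable
  have hκ : P.map f ⊗ₘ condDistrib id f P = P.map (fun x => (f x, x)) :=
    compProd_map_condDistrib (μ := P) (X := f) (Y := id) measurable_id.aemeasurable
  refine Measure.ext_of_lintegral _ fun F hF => ?_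
  have hG : Measurable (fun p : 𝓢 × 𝓦 × 𝓧 => ∫⁻ n, F (p.2.2, (g (p.1, p.2.1), n)) ∂ρ) :=
    Measurable.lintegral_prod_right'
      (f := fun q : (𝓢 × 𝓦 × 𝓧) × 𝓝 => F (q.1.2.2, (g (q.1.1, q.1.2.1), q.2))) (by fun_prop)
  have hGw : Measurable (fun p : 𝓢 × 𝓧 => ∫⁻ w, ∫⁻ n, F (p.2, (g (p.1, w), n)) ∂ρ ∂γ) :=
    Measurable.lintegral_prod_right'
      (f := fun q : (𝓢 × 𝓧) × 𝓦 => ∫⁻ n, F (q.1.2, (g (q.1.1, q.2), n)) ∂ρ)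
      (hG.comp (by fun_prop : Measurable fun q : (𝓢 × 𝓧) × 𝓦 => (q.1.1, q.2, q.1.2)))
  have hFT : Measurable (fun q : (𝓢 × 𝓡) × (𝓧 × 𝓝) => F (q.2.1, (q.1.2, q.2.2))) := by fun_prop
  have hm : Measurable (fun ω : 𝓢 × 𝓦 => (ω.1, g ω)) := by fun_prop
  rw [lintegral_map hF (by fun_prop), lintegral_map hF (by fun_prop),
    Measure.lintegral_compProd hFT, lintegral_map hFT.lintegral_kernel_prod_right' hm]
  calc _ = ∫⁻ s, ∫⁻ w, ∫⁻ x, ∫⁻ n, F (x, (g (s, w), n)) ∂ρ ∂(condDistrib id f P s) ∂γ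
        ∂(P.map f) := by
        refine (lintegral_prod _ (hFT.lintegral_kernel_prod_right'.comp hm).aemeasurable).trans
          (lintegral_congr fun s => lintegral_congr fun w => ?_)
        rw [Function.comp_apply, Kernel.prod_apply, Kernel.comap_apply, Kernel.const_apply, lintegral_prod _ (by fun_prop)]
    _ = ∫⁻ s, ∫⁻ x, ∫⁻ w, ∫⁻ n, F (x, (g (s, w), n)) ∂ρ ∂γ ∂(condDistrib id f P s)
        ∂(P.map f) := by
        refine lintegral_congr fun s => lintegral_lintegral_swap (Measurable.aemeasurable ?_)
        exact hG.comp (by fun_prop : Measurable fun q : 𝓦 × 𝓧 => (s, q.1, q.2))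
    _ = ∫⁻ x, ∫⁻ w, ∫⁻ n, F (x, (g (f x, w), n)) ∂ρ ∂γ ∂P := by
        rw [← Measure.lintegral_compProd (f := fun p : 𝓢 × 𝓧 =>
          ∫⁻ w, ∫⁻ n, F (p.2, (g (p.1, w), n)) ∂ρ ∂γ) hGw, hκ, lintegral_map hGw (by fun_prop)]
    _ = _ := by
        rw [lintegral_prod _ (by fun_prop)]
        refine lintegral_congr fun x => ?_
        rw [lintegral_prod _ (by fun_prop)]

/-- If the channel output depends on the input `X` through `f X` only, and an independent noise
component is observed in addition, then the mutual information is that between `f X` and the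
informative component of the output. -/
lemma mutualInfo_sufficient [StandardBorelSpace 𝓧] [Nonempty 𝓧]
    (P : Measure 𝓧) [IsProbabilityMeasure P] (γ : Measure 𝓦) [IsProbabilityMeasure γ]
    (ρ : Measure 𝓝) [IsProbabilityMeasure ρ] {f : 𝓧 → 𝓢} (hf : Measurable f)
    {g : 𝓢 × 𝓦 → 𝓡} (hg : Measurable g) :
    mutualInfo (P.prod (γ.prod ρ)) (fun ω => ω.1)
        (fun ω => (g (f ω.1, ω.2.1), ω.2.2)) =
      mutualInfo ((P.map f).prod γ) (fun ω => ω.1) g := by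
  have : IsProbabilityMeasure (P.map f) := Measure.isProbabilityMeasure_map hf.aemeasurable
  have hmap : (P.prod (γ.prod ρ)).map (fun ω : 𝓧 × 𝓦 × 𝓝 => (f ω.1, ω.2.1)) =
      (P.map f).prod γ := by
    have h1 := Measure.map_prod_map P (γ.prod ρ) hf measurable_fst
    rw [← Measure.fst, Measure.fst_prod] at h1
    exact h1.symm
  apply le_antisymm
  · set R : Measure 𝓡 := ((P.map f).prod γ).map g with hR
    have : IsProbabilityMeasure R := Measure.isProbabilityMeasure_map hg.aemeasurable
    have hY : (P.prod (γ.prod ρ)).map (fun ω : 𝓧 × 𝓦 × 𝓝 => (g (f ω.1, ω.2.1), ω.2.2)) =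
        R.prod ρ := by
      refine Measure.ext_of_lintegral _ fun F hF => ?_
      have hG : Measurable (fun r => ∫⁻ n, F (r, n) ∂ρ) := hF.lintegral_prod_right'
      have hGw : Measurable (fun ω : 𝓧 × 𝓦 × 𝓝 => ∫⁻ n, F (g (f ω.1, ω.2.1), n) ∂ρ) :=
        hG.comp (by fun_prop : Measurable fun ω : 𝓧 × 𝓦 × 𝓝 => g (f ω.1, ω.2.1))
      rw [lintegral_map hF (by fun_prop), lintegral_prod _ (by fun_prop),
        lintegral_prod _ hF.aemeasurable, hR, lintegral_map hG hg, ← hmap,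
        lintegral_map (f := fun a => ∫⁻ n, F (g a, n) ∂ρ) (hG.comp hg) (by fun_prop)]
      refine (lintegral_congr fun x => ?_).trans (lintegral_prod _ hGw.aemeasurable).symm
      rw [lintegral_prod _ (by fun_prop)]
      refine Eq.trans ?_ (lintegral_prod _ (hGw.comp
        (by fun_prop : Measurable fun q : 𝓦 × 𝓝 => (x, q))).aemeasurable).symm
      simp
    -- One kernel produces both arguments of the divergence: the joint law from that of the input `f
    -- X` and its output, and the product law from the case where the output has law `R`
    -- independently of `f X`.
    have h1 := map_compProd_condDistrib P γ ρ hf hg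
    have h2 := map_compProd_condDistrib P R ρ hf (g := Prod.snd) measurable_snd
    simp only [Prod.mk.eta, Measure.map_id'] at h2
    unfold mutualInfo
    rw [hY, ← hR, ← Measure.fst, ← Measure.fst, Measure.fst_prod, Measure.fst_prod, ← h1, ← h2]
    -- Forgetting `f X` cannot increase the divergence, and extending two laws by the same kernel
    -- leaves it unchanged.
    refine (InformationTheory.klDiv_map_le _ _ (by fun_prop)).trans_eq ?_
    have : IsProbabilityMeasure (((P.map f).prod γ).map (fun ω => (ω.1, g ω))) :=
      Measure.isProbabilityMeasure_map (by fun_prop)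
    exact InformationTheory.klDiv_compProd_left _ _ _
  · rw [← hmap, mutualInfo_map (by fun_prop) measurable_fst hg]
    exact mutualInfo_comp_le (X := fun ω : 𝓧 × 𝓦 × 𝓝 => ω.1)
      (Y := fun ω => (g (f ω.1, ω.2.1), ω.2.2)) measurable_fst (by fun_prop) hf measurable_fst

end Information

/-! ### Gaussian noise and rank-one channels -/

/-- White Gaussian noise is invariant under rotations. -/
lemma awgn_eq_map_pi {m : ℕ} (σ : ℝ) {U : Matrix (Fin m) (Fin m) ℝ}
    (hU : U ∈ Matrix.orthogonalGroup (Fin m) ℝ) :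
    awgn m σ = (Measure.pi fun _ : Fin m => gaussianReal 0 (σ ^ 2).toNNReal).map
      (fun z => WithLp.toLp 2 (U *ᵥ z)) := by
  have hUU : U * Uᵀ = 1 := (Matrix.mem_orthogonalGroup_iff _ _).1 hU
  have hm : Measurable (fun z : Fin m → ℝ => WithLp.toLp 2 (U *ᵥ z)) := by
    fun_prop
  have : IsFiniteMeasure (awgn m σ) := by unfold awgn; infer_instance
  apply Measure.ext_of_charFun (E := EuclideanSpace ℝ (Fin m))
  ext t
  have hS : (σ ^ 2 • (1 : Matrix (Fin m) (Fin m) ℝ)).PosSemidef :=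
    Matrix.PosSemidef.one.smul (sq_nonneg σ)
  have h1 : charFun ((Measure.pi fun _ : Fin m => gaussianReal 0 (σ ^ 2).toNNReal).map
      (fun z => WithLp.toLp 2 (U *ᵥ z))) t =
      charFun ((Measure.pi fun _ : Fin m => gaussianReal 0 (σ ^ 2).toNNReal).map (WithLp.toLp 2))
        (WithLp.toLp 2 (Uᵀ *ᵥ WithLp.ofLp t)) := by
    rw [charFun_apply, charFun_apply, integral_map hm.aemeasurable (by fun_prop),
      integral_map (by fun_prop) (by fun_prop)]
    refine integral_congr_ae (ae_of_all _ fun z => ?_)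
    simp only [EuclideanSpace.inner_eq_star_dotProduct, star_trivial]
    rw [Matrix.dotProduct_mulVec, Matrix.mulVec_transpose]
  rw [h1, charFun_pi, awgn, charFun_multivariateGaussian hS]
  simp_rw [charFun_gaussianReal, ← Complex.exp_sum]
  congr 1
  have h2 : WithLp.ofLp t ⬝ᵥ WithLp.ofLp t =
      (Uᵀ *ᵥ WithLp.ofLp t) ⬝ᵥ (Uᵀ *ᵥ WithLp.ofLp t) := by
    rw [Matrix.dotProduct_mulVec, Matrix.vecMul_transpose, Matrix.mulVec_mulVec, hUU,
      Matrix.one_mulVec]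
  rw [Matrix.smul_mulVec, Matrix.one_mulVec, dotProduct_smul, h2]
  simp [dotProduct, Finset.mul_sum, Finset.sum_div, pow_two, mul_assoc,
    max_eq_left (mul_self_nonneg σ)]

lemma awgn_succ_eq_map {m : ℕ} (σ : ℝ) {U : Matrix (Fin (m + 1)) (Fin (m + 1)) ℝ}
    (hU : U ∈ Matrix.orthogonalGroup (Fin (m + 1)) ℝ) :
    awgn (m + 1) σ = ((gaussianReal 0 (σ ^ 2).toNNReal).prod
      (Measure.pi fun _ : Fin m => gaussianReal 0 (σ ^ 2).toNNReal)).map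
      (fun z => WithLp.toLp 2 (U *ᵥ (Fin.cons z.1 z.2 : Fin (m + 1) → ℝ))) := by
  have h := (measurePreserving_piFinSuccAbove
    (fun _ : Fin (m + 1) => gaussianReal 0 (σ ^ 2).toNNReal) 0).symm.map_eq
  rw [awgn_eq_map_pi σ hU, ← h, Measure.map_map (by fun_prop) (MeasurableEquiv.measurable _)]
  congr 1
  ext z i
  simp [MeasurableEquiv.piFinSuccAbove]
  rfl

lemma IsSVD.apply_of_rank_one {m n : ℕ} {H : Matrix (Fin (m + 1)) (Fin (n + 1)) ℝ}
    {U : Matrix (Fin (m + 1)) (Fin (m + 1)) ℝ} {B : Matrix (Fin (m + 1)) (Fin (n + 1)) ℝ}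
    {V : Matrix (Fin (n + 1)) (Fin (n + 1)) ℝ} (h : IsSVD H U B V) (hr : H.rank = 1)
    (i : Fin (m + 1)) (j : Fin (n + 1)) : H i j = U i 0 * B 0 0 * V j 0 := by
  have hB : ∀ i j, ¬ (i = 0 ∧ j = 0) → B i j = 0 := by
    intro i j hij
    by_cases he : (i : ℕ) = j
    · refine h.zero i j he ?_
      rw [hr, Nat.one_le_iff_ne_zero]
      intro h0
      exact hij ⟨Fin.ext h0, Fin.ext (by rw [← he, h0]; rfl)⟩
    · exact h.off_diagonal i j he
  rw [h.eq_mul, Matrix.mul_apply, Finset.sum_eq_single 0, Matrix.mul_apply,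
    Finset.sum_eq_single 0, Matrix.transpose_apply]
  · intro k _ hk; rw [hB k 0 (by simp [hk]), mul_zero]
  · simp
  · intro k _ hk
    rw [Matrix.mul_apply, Finset.sum_eq_zero, zero_mul]
    intro l _; rw [hB l k (by simp [hk]), mul_zero]
  · simp

/-- In a row where the left singular vector is nonzero, the row sum is nonnegative, so the sign
choice for the right vector makes that left entry positive; the entries of the row then carry the
signs of the right vector. -/
lemma IsSVD.right_nonneg_of_rank_one {m n : ℕ} {H : Matrix (Fin (m + 1)) (Fin (n + 1)) ℝ}
    {U : Matrix (Fin (m + 1)) (Fin (m + 1)) ℝ} {B : Matrix (Fin (m + 1)) (Fin (n + 1)) ℝ}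
    {V : Matrix (Fin (n + 1)) (Fin (n + 1)) ℝ} (h : IsSVD H U B V) (hr : H.rank = 1)
    (hH : ∀ i j, 0 ≤ H i j) (hV : 0 < ∑ j, V j 0) (j : Fin (n + 1)) : 0 ≤ V j 0 := by
  have hB : 0 < B 0 0 := h.pos 0 0 rfl (by simp [hr])
  obtain ⟨i, hi⟩ : ∃ i, U i 0 ≠ 0 := by
    by_contra! hU
    have h1 : (Uᵀ * U) 0 0 = 1 := by
      rw [show Uᵀ * U = 1 from (Matrix.mem_orthogonalGroup_iff' _ _).1 h.left_orthogonal,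
        Matrix.one_apply_eq]
    simp [Matrix.mul_apply, hU] at h1
  have hrow : 0 ≤ U i 0 * B 0 0 * ∑ j, V j 0 := by
    rw [Finset.mul_sum]
    exact Finset.sum_nonneg fun j _ => h.apply_of_rank_one hr i j ▸ hH i j
  have hU : 0 < U i 0 := by
    refine lt_of_le_of_ne (le_of_mul_le_mul_right ?_ (mul_pos hB hV)) hi.symm
    rwa [zero_mul, ← mul_assoc]
  have := hH i j
  rw [h.apply_of_rank_one hr] at this
  exact nonneg_of_mul_nonneg_right this (mul_pos hU hB)

/-- For a channel matrix `c u vᵀ` with `u` the first column of the orthogonal matrix `U`, the mutual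
information is that of the scalar channel whose input is `(∑ i, v i * X i) / L`. -/
lemma mutualInfo_rank_one {m n : ℕ} {H : Matrix (Fin (m + 1)) (Fin n) ℝ}
    {U : Matrix (Fin (m + 1)) (Fin (m + 1)) ℝ}
    (hU : U ∈ Matrix.orthogonalGroup (Fin (m + 1)) ℝ) {c L : ℝ} (hc : c ≠ 0) (hL : L ≠ 0)
    {v : Fin n → ℝ} (hH : ∀ i j, H i j = U i 0 * c * v j) (σ : ℝ)
    (P : Measure (Fin n → ℝ)) [IsProbabilityMeasure P] :
    mutualInfo (P.prod (awgn (m + 1) σ)) (fun ω => ω.1)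
        (fun ω => WithLp.toLp 2 (H *ᵥ ω.1) + ω.2) =
      mutualInfo ((P.map fun x => (∑ i, v i * x i) / L).prod (gaussianReal 0 (σ ^ 2).toNNReal))
        (fun ω => ω.1) (fun ω => ω.1 + ω.2 / (c * L)) := by
  set γ := gaussianReal 0 (σ ^ 2).toNNReal
  set ρ : Measure (Fin m → ℝ) := Measure.pi fun _ : Fin m => γ
  have hUU : Uᵀ * U = 1 := (Matrix.mem_orthogonalGroup_iff' _ _).1 hU
  have hcL : c * L ≠ 0 := mul_ne_zero hc hL
  let Ψ : ℝ × (Fin m → ℝ) → EuclideanSpace ℝ (Fin (m + 1)) :=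
    fun z => WithLp.toLp 2 (U *ᵥ (Fin.cons z.1 z.2 : Fin (m + 1) → ℝ))
  have hcons : Measurable (fun z : ℝ × (Fin m → ℝ) => (Fin.cons z.1 z.2 : Fin (m + 1) → ℝ)) :=
    measurable_pi_iff.2 fun i => Fin.cases (by simpa using measurable_fst)
      (fun j => by simp only [Fin.cons_succ]; fun_prop) i
  have hΨ : Measurable Ψ := by fun_prop
  let T : (Fin n → ℝ) × (ℝ × (Fin m → ℝ)) → (Fin n → ℝ) × EuclideanSpace ℝ (Fin (m + 1)) :=
    fun ω => (ω.1, Ψ ω.2)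
  have hT : Measurable T := by fun_prop
  have hmap : P.prod (awgn (m + 1) σ) = (P.prod (γ.prod ρ)).map T := by
    rw [awgn_succ_eq_map σ hU]
    conv_lhs => rw [← Measure.map_id (μ := P)]
    exact Measure.map_prod_map _ _ measurable_id hΨ
  rw [hmap, mutualInfo_map hT measurable_fst (by fun_prop)]
  have hY : ∀ ω : (Fin n → ℝ) × (ℝ × (Fin m → ℝ)),
      WithLp.toLp 2 (H *ᵥ (T ω).1) + (T ω).2 =
        Ψ (c * L * ((∑ i, v i * ω.1 i) / L + ω.2.1 / (c * L)), ω.2.2) := by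
    intro ω
    have h1 : H *ᵥ ω.1 = U *ᵥ (Fin.cons (c * ∑ i, v i * ω.1 i) 0 : Fin (m + 1) → ℝ) := by
      ext i
      simp [Matrix.mulVec, dotProduct, Fin.sum_univ_succ, hH, Finset.mul_sum, mul_assoc]
    simp only [T, Ψ, h1, ← WithLp.toLp_add, ← Matrix.mulVec_add]
    congr 2
    ext i
    refine Fin.cases ?_ (fun j => ?_) i
    · simp; field_simp
    · simp
  simp_rw [hY]
  have h2 := mutualInfo_sufficient P γ ρ (f := fun x => (∑ i, v i * x i) / L) (by fun_prop)
    (g := fun ω => ω.1 + ω.2 / (c * L)) (by fun_prop)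
  rw [← h2]
  refine mutualInfo_comp_right_of_leftInverse (μ := P.prod (γ.prod ρ))
    (X := fun ω => ω.1) (g := fun p => Ψ (c * L * p.1, p.2))
    (Y := fun ω => ((∑ i, v i * ω.1 i) / L + ω.2.1 / (c * L), ω.2.2))
    -- Rotating back and rescaling the signal coordinate loses no information.
    (g' := fun y => ((Uᵀ *ᵥ WithLp.ofLp y) 0 / (c * L), Fin.tail (Uᵀ *ᵥ WithLp.ofLp y)))
    measurable_fst (by fun_prop) (by fun_prop) ?_ ?_
  · refine Measurable.prodMk (by fun_prop) (measurable_pi_iff.2 fun i => ?_)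
    simp only [Fin.tail]
    fun_prop
  · rintro ⟨r, z⟩
    simp [Ψ, Matrix.mulVec_mulVec, hUU, hcL]

/-! ### Weighted majorization -/

section Majorization

variable {n : ℕ}

/-- The transfer of the amount `θ * (x j - x k)` from the coordinate `j` to the coordinate `k`,
which preserves the sum of the coordinates of `x` weighted by `w`. -/
noncomputable def weightedTransfer (w : Fin n → ℝ) (θ : ℝ) (j k : Fin n) (x : Fin n → ℝ) :
    Fin n → ℝ :=
  fun i => x i + (if i = k then θ / w k * (x j - x k) else 0) -
    (if i = j then θ / w j * (x j - x k) else 0)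

lemma sum_mul_weightedTransfer {w : Fin n → ℝ} (θ : ℝ) {j k : Fin n} (hj : w j ≠ 0)
    (hk : w k ≠ 0) (x : Fin n → ℝ) (s : Finset (Fin n)) :
    ∑ i ∈ s, w i * weightedTransfer w θ j k x i =
      ∑ i ∈ s, w i * x i + (if k ∈ s then θ * (x j - x k) else 0) -
        (if j ∈ s then θ * (x j - x k) else 0) := by
  have hk' : w k * (θ / w k * (x j - x k)) = θ * (x j - x k) := by field_simp
  have hj' : w j * (θ / w j * (x j - x k)) = θ * (x j - x k) := by field_simp
  simp only [weightedTransfer, mul_sub, mul_add, mul_ite, mul_zero, Finset.sum_sub_distrib,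
    Finset.sum_add_distrib, Finset.sum_ite_eq']
  simp only [← mul_sub, hk', hj']

/-- Since `θ` is at most both weights, each of the two new coordinates is a convex combination of
the old ones. -/
lemma weightedTransfer_mem_Icc {w : Fin n → ℝ} {θ : ℝ} {j k : Fin n} (hjk : j ≠ k)
    (hθ : 0 ≤ θ) (hj : 0 < w j) (hk : 0 < w k) (hθj : θ ≤ w j) (hθk : θ ≤ w k) {x : Fin n → ℝ}
    (hx : ∀ i, x i ∈ Set.Icc (0 : ℝ) 1) (i : Fin n) :
    weightedTransfer w θ j k x i ∈ Set.Icc (0 : ℝ) 1 := by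
  have h (a b r : ℝ) (ha : a ∈ Set.Icc (0 : ℝ) 1) (hb : b ∈ Set.Icc (0 : ℝ) 1) (hr : 0 ≤ r)
      (hr' : r ≤ 1) : a + r * (b - a) ∈ Set.Icc (0 : ℝ) 1 := by
    obtain ⟨ha0, ha1⟩ := ha
    obtain ⟨hb0, hb1⟩ := hb
    constructor <;> nlinarith
  by_cases hik : i = k
  · subst hik
    simpa [weightedTransfer, hjk.symm] using
      h (x i) (x j) (θ / w i) (hx _) (hx _) (by positivity) ((div_le_one hk).2 hθk)
  by_cases hij : i = j
  · subst hij
    have := h (x i) (x k) (θ / w i) (hx _) (hx _) (by positivity) ((div_le_one hj).2 hθj)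
    simp only [weightedTransfer, hik, if_true, if_false]
    convert this using 1
    ring
  · simpa [weightedTransfer, hik, hij] using hx i

/-- A weighted **Hardy–Littlewood–Pólya theorem**: if the weighted partial sums of `β` dominate
those of the nonincreasing vector `α`, with equality of the total sums, then `α` is obtained from
`β` by weighted transfers, up to coordinates of weight zero. -/
theorem exists_eq_of_weighted_majorization {w α : Fin n → ℝ} (hw : ∀ i, 0 ≤ w i)
    (hα : Antitone α) {𝓑 : Set (Fin n → ℝ)}
    (h𝓑 : ∀ β ∈ 𝓑, ∀ j k θ, j ≠ k → 0 ≤ θ → 0 < w j → 0 < w k → θ ≤ w j → θ ≤ w k →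
      weightedTransfer w θ j k β ∈ 𝓑) (β : Fin n → ℝ) (hβ : β ∈ 𝓑)
    (hsum : ∑ i, w i * β i = ∑ i, w i * α i)
    (hle : ∀ m : ℕ, ∑ i ∈ Finset.univ.filter (fun i : Fin n => (i : ℕ) < m), w i * α i ≤
      ∑ i ∈ Finset.univ.filter (fun i : Fin n => (i : ℕ) < m), w i * β i) :
    ∃ β' ∈ 𝓑, ∀ i, 0 < w i → β' i = α i := by
  induction hN : (Finset.univ.filter fun i => 0 < w i ∧ β i ≠ α i).card
    using Nat.strong_induction_on generalizing β with
  | _ N ih =>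
  by_cases hex : ∃ k, 0 < w k ∧ β k < α k
  swap
  · push Not at hex
    refine ⟨β, hβ, fun i hi => ?_⟩
    have hterm : ∀ i ∈ Finset.univ, w i * α i ≤ w i * β i := fun i _ => by
      rcases (hw i).eq_or_lt with h0 | h0
      · simp [← h0]
      · exact mul_le_mul_of_nonneg_left (hex i h0) h0.le
    have := (Finset.sum_eq_sum_iff_of_le hterm).1 hsum.symm i (Finset.mem_univ i)
    exact (mul_left_cancel₀ hi.ne' this).symm
  obtain ⟨k, ⟨hwk, hk⟩, hmin⟩ :=
    WellFounded.has_min (wellFounded_lt (α := Fin n)) {k | 0 < w k ∧ β k < α k} hex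
  have hbefore : ∀ i < k, w i * α i ≤ w i * β i := fun i hi => by
    rcases (hw i).eq_or_lt with h0 | h0
    · simp [← h0]
    · exact mul_le_mul_of_nonneg_left (not_lt.1 fun h => hmin i ⟨h0, h⟩ hi) h0.le
  -- Without a surplus before the first deficit `k`, the partial sum through `k` would violate
  -- `hle`.
  obtain ⟨j, hjk, hwj, hj⟩ : ∃ j < k, 0 < w j ∧ α j < β j := by
    by_contra! hno
    refine (hle (k + 1)).not_gt (Finset.sum_lt_sum (fun i hi => ?_)
      ⟨k, by simp, mul_lt_mul_of_pos_left hk hwk⟩)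
    have hik : i ≤ k := by
      rw [Finset.mem_filter] at hi
      exact Fin.le_def.2 (by omega)
    rcases (hw i).eq_or_lt with h0 | h0
    · simp [← h0]
    · rcases hik.eq_or_lt with rfl | hlt
      · exact mul_le_mul_of_nonneg_left hk.le h0.le
      · exact mul_le_mul_of_nonneg_left (hno i hlt h0) h0.le
  have hαjk := hα hjk.le
  have hd : 0 < β j - β k := by linarith
  -- The largest weighted amount that overshoots neither target. It settles at least one of `j`,
  -- `k`, so the number of wrong coordinates drops.
  set δ := min (w j * (β j - α j)) (w k * (α k - β k)) with hδ
  have hδ0 : 0 < δ := lt_min (mul_pos hwj (by linarith)) (mul_pos hwk (by linarith))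
  have hδj : δ ≤ w j * (β j - α j) := min_le_left _ _
  have hδk : δ ≤ w k * (α k - β k) := min_le_right _ _
  set θ := δ / (β j - β k) with hθ
  have hθd : θ * (β j - β k) = δ := div_mul_cancel₀ _ hd.ne'
  have hθ0 : 0 ≤ θ := (div_pos hδ0 hd).le
  -- Monotonicity of `α` enters here: β k < α k ≤ α j < β j, so surplus and deficit are both at most
  -- β j - β k.
  have hθj : θ ≤ w j := (div_le_iff₀ hd).2
    (hδj.trans (mul_le_mul_of_nonneg_left (by linarith) hwj.le))
  have hθk : θ ≤ w k := (div_le_iff₀ hd).2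
    (hδk.trans (mul_le_mul_of_nonneg_left (by linarith) hwk.le))
  set β' := weightedTransfer w θ j k β with hβ'
  have hβ'k : β' k = β k + δ / w k := by
    simp only [hβ', weightedTransfer, if_true, if_neg hjk.ne', div_mul_eq_mul_div, hθd, sub_zero]
  have hβ'j : β' j = β j - δ / w j := by
    simp only [hβ', weightedTransfer, if_true, if_neg hjk.ne, div_mul_eq_mul_div, hθd, add_zero]
  have hβ'i : ∀ i, i ≠ j → i ≠ k → β' i = β i := fun i hij hik => by
    simp [hβ', weightedTransfer, hij, hik]
  refine ih _ ?_ β' (h𝓑 β hβ j k θ hjk.ne hθ0 hwj hwk hθj hθk) ?_ ?_ rfl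
  · rw [← hN]
    refine Finset.card_lt_card (Finset.ssubset_iff_subset_ne.2 ⟨fun i hi => ?_, fun h => ?_⟩)
    · simp only [Finset.mem_filter, Finset.mem_univ, true_and] at hi ⊢
      refine ⟨hi.1, ?_⟩
      by_cases hij : i = j
      · exact hij ▸ hj.ne'
      by_cases hik : i = k
      · exact hik ▸ hk.ne
      rw [← hβ'i i hij hik]
      exact hi.2
    · rcases min_choice (w j * (β j - α j)) (w k * (α k - β k)) with h1 | h1
      · have hjm : j ∈ Finset.univ.filter fun i => 0 < w i ∧ β i ≠ α i := by simp [hwj, hj.ne']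
        rw [← h, Finset.mem_filter] at hjm
        refine hjm.2.2 ?_
        rw [hβ'j, hδ, h1, mul_div_cancel_left₀ _ hwj.ne']
        ring
      · have hkm : k ∈ Finset.univ.filter fun i => 0 < w i ∧ β i ≠ α i := by simp [hwk, hk.ne]
        rw [← h, Finset.mem_filter] at hkm
        refine hkm.2.2 ?_
        rw [hβ'k, hδ, h1, mul_div_cancel_left₀ _ hwk.ne']
        ring
  · rw [sum_mul_weightedTransfer θ hwj.ne' hwk.ne']
    simpa using hsum
  · intro m
    rw [sum_mul_weightedTransfer θ hwj.ne' hwk.ne', hθd]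
    simp only [Finset.mem_filter, Finset.mem_univ, true_and]
    have hm := hle m
    have hjk' : (j : ℕ) < k := hjk
    by_cases hkm : (k : ℕ) < m
    · rw [if_pos hkm, if_pos (hjk'.trans hkm)]
      linarith
    by_cases hjm : (j : ℕ) < m
    · rw [if_neg hkm, if_pos hjm]
      -- For j < m ≤ k the partial sum loses `δ`. No coordinate before `k` is deficient, so its
      -- slack is at least the surplus at `j`, which covers the loss.
      have h1 : w j * β j - w j * α j ≤
          ∑ i ∈ Finset.univ.filter (fun i : Fin n => (i : ℕ) < m), (w i * β i - w i * α i) := by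
        refine Finset.single_le_sum (f := fun i => w i * β i - w i * α i) (fun i hi => ?_)
          (by simpa using hjm)
        rw [Finset.mem_filter] at hi
        exact sub_nonneg.2 (hbefore i (Fin.lt_def.2 (by omega)))
      rw [Finset.sum_sub_distrib] at h1
      linarith
    · rw [if_neg hkm, if_neg hjm]
      linarith

end Majorization

/-! ### Stop-loss constraints and allocations -/

section StopLoss

variable {n : ℕ}

lemma sum_filter_lt_sub (F : ℕ → ℝ) {m : ℕ} (hm : m ≤ n) :
    ∑ i ∈ Finset.univ.filter (fun i : Fin n => (i : ℕ) < m), (F (i + 1) - F i) = F m - F 0 := by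
  rw [← Finset.sum_range_sub F m]
  refine Finset.sum_bij (fun i _ => (i : ℕ)) (by simp) (by simp [Fin.ext_iff])
    (fun b hb => ⟨⟨b, (Finset.mem_range.1 hb).trans_le hm⟩, by simpa using hb, rfl⟩) (by simp)

lemma sum_filter_lt_add_sum_filter_le (a : Fin n → ℝ) (m : ℕ) :
    ∑ i ∈ Finset.univ.filter (fun i : Fin n => (i : ℕ) < m), a i +
      ∑ i ∈ Finset.univ.filter (fun i : Fin n => m ≤ (i : ℕ)), a i = ∑ i, a i := by
  rw [← Finset.sum_filter_add_sum_filter_not Finset.univ (fun i : Fin n => (i : ℕ) < m)]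
  simp only [not_lt]

/-- The law of the weighted average of a vector that satisfies the equal-cost constraints
satisfies the stop-loss constraints. -/
lemma IsECInput.isStopLossInput_map {v α : Fin n → ℝ} (hv : ∀ i, 0 ≤ v i) (hL : 0 < ∑ i, v i)
    {P : Measure (Fin n → ℝ)} (h : IsECInput α P) :
    IsStopLossInput v α (P.map fun x => (∑ i, v i * x i) / ∑ i, v i) := by
  have := h.isProbabilityMeasure
  have hf : Measurable (fun x : Fin n → ℝ => (∑ i, v i * x i) / ∑ i, v i) := by fun_prop
  have hx : ∀ᵐ x ∂P, ∀ k, x k ∈ Set.Icc (0 : ℝ) 1 := by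
    have h1 : ∀ᵐ x ∂P, ∀ k, x k ≤ 1 := ae_all_iff.2 fun k => by
      simpa [ae_iff] using h.peak k
    filter_upwards [h.nonneg, h1] with x h0 h1 k using ⟨h0 k, h1 k⟩
  have hint : ∀ k, Integrable (fun x : Fin n → ℝ => x k) P := fun k =>
    Integrable.of_mem_Icc 0 1 (measurable_pi_apply k).aemeasurable (hx.mono fun x hx => hx k)
  refine ⟨Measure.isProbabilityMeasure_map hf.aemeasurable, ?_, ?_, fun k hk1 hkn => ?_⟩
  · refine (ae_map_iff hf.aemeasurable measurableSet_Icc).2 ?_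
    filter_upwards [hx] with x hx
    refine ⟨div_nonneg (Finset.sum_nonneg fun i _ => mul_nonneg (hv i) (hx i).1) hL.le,
      (div_le_one hL).2 (Finset.sum_le_sum fun i _ => ?_)⟩
    exact mul_le_of_le_one_right (hv i) (hx i).2
  · rw [integral_map hf.aemeasurable (by fun_prop), integral_div,
      integral_finsetSum _ fun i _ => (hint i).const_mul _]
    simp_rw [integral_const_mul, h.mean]
    rw [div_eq_inv_mul, one_div]
  · rw [integral_map hf.aemeasurable (by fun_prop)]
    have hint2 : Integrable (fun x : Fin n → ℝ => (1 / ∑ i, v i) *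
        ∑ i ∈ Finset.univ.filter (fun i : Fin n => k ≤ (i : ℕ)), v i * x i) P :=
      (integrable_finsetSum _ fun i _ => (hint i).const_mul _).const_mul _
    calc _ ≤ ∫ x, (1 / ∑ i, v i) *
          ∑ i ∈ Finset.univ.filter (fun i : Fin n => k ≤ (i : ℕ)), v i * x i ∂P := by
          refine integral_mono_of_nonneg (ae_of_all _ fun x => le_max_right _ _) hint2 ?_
          filter_upwards [hx] with x hx
          refine max_le ?_ (mul_nonneg (by positivity)
            (Finset.sum_nonneg fun i _ => mul_nonneg (hv i) (hx i).1))
          rw [← sum_filter_lt_add_sum_filter_le (fun i => v i * x i) k, ← Finset.sum_div,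
            ← sub_div, one_div, inv_mul_eq_div]
          refine div_le_div_of_nonneg_right ?_ hL.le
          have : ∑ i ∈ Finset.univ.filter (fun i : Fin n => (i : ℕ) < k), v i * x i ≤
              ∑ i ∈ Finset.univ.filter (fun i : Fin n => (i : ℕ) < k), v i :=
            Finset.sum_le_sum fun i _ => mul_le_of_le_one_right (hv i) (hx i).2
          linarith
      _ = _ := by
          rw [integral_const_mul, integral_finsetSum _ fun i _ => (hint i).const_mul _]
          simp_rw [integral_const_mul, h.mean]

/-- A measurable way to write each `s ∈ [0, 1]` as a weighted sum of numbers in `[0, 1]`. -/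
structure IsAllocation (w : Fin n → ℝ) (φ : ℝ → Fin n → ℝ) : Prop where
  measurable : Measurable φ
  mem_Icc : ∀ s ∈ Set.Icc (0 : ℝ) 1, ∀ i, φ s i ∈ Set.Icc (0 : ℝ) 1
  sum_mul : ∀ s ∈ Set.Icc (0 : ℝ) 1, ∑ i, w i * φ s i = s

lemma IsAllocation.transfer {w : Fin n → ℝ} {φ : ℝ → Fin n → ℝ} (hφ : IsAllocation w φ)
    {θ : ℝ} {j k : Fin n} (hjk : j ≠ k) (hθ : 0 ≤ θ) (hj : 0 < w j) (hk : 0 < w k)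
    (hθj : θ ≤ w j) (hθk : θ ≤ w k) :
    IsAllocation w (fun s => weightedTransfer w θ j k (φ s)) := by
  have h := hφ.measurable
  refine ⟨measurable_pi_iff.2 fun i => ?_, fun s hs i => weightedTransfer_mem_Icc hjk hθ hj hk hθj
    hθk (hφ.mem_Icc s hs) i, fun s hs => ?_⟩
  · unfold weightedTransfer
    split_ifs <;> fun_prop
  · rw [sum_mul_weightedTransfer θ hj.ne' hk.ne']
    simpa using hφ.sum_mul s hs

lemma IsAllocation.integrable {w : Fin n → ℝ} {φ : ℝ → Fin n → ℝ} (hφ : IsAllocation w φ)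
    {Q : Measure ℝ} [IsProbabilityMeasure Q] (hQ : ∀ᵐ s ∂Q, s ∈ Set.Icc (0 : ℝ) 1) (i : Fin n) :
    Integrable (fun s => φ s i) Q :=
  Integrable.of_mem_Icc 0 1 ((measurable_pi_apply i).comp hφ.measurable).aemeasurable
    (hQ.mono fun s hs => hφ.mem_Icc s hs i)

/-- The allocation that fills the coordinates one after the other. -/
lemma exists_greedy_allocation {w : Fin n → ℝ} (hw : ∀ i, 0 ≤ w i) (hw1 : ∑ i, w i = 1) :
    ∃ φ, IsAllocation w φ ∧ ∀ s, 0 ≤ s → ∀ m ≤ n,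
      ∑ i ∈ Finset.univ.filter (fun i : Fin n => (i : ℕ) < m), w i * φ s i =
        min s (∑ i ∈ Finset.univ.filter (fun i : Fin n => (i : ℕ) < m), w i) := by
  set t : ℕ → ℝ := fun m => ∑ i ∈ Finset.univ.filter (fun i : Fin n => (i : ℕ) < m), w i with ht
  have ht0 : t 0 = 0 := by simp [ht]
  have htn : t n = 1 := by simp [ht, hw1]
  have hts : ∀ i : Fin n, t (i + 1) = t i + w i := fun i => by
    have : Finset.univ.filter (fun j : Fin n => (j : ℕ) < i + 1) =
        insert i (Finset.univ.filter (fun j : Fin n => (j : ℕ) < i)) := by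
      ext j
      simp [Fin.ext_iff]
      omega
    simp only [ht, this]
    rw [Finset.sum_insert (by simp), add_comm]
  -- The length of [0, s] ∩ [t i, t (i + 1)] relative to `w i`. At zero weight the numerator
  -- vanishes too, so division by zero is harmless.
  let φ : ℝ → Fin n → ℝ := fun s i => (min s (t (i + 1)) - min s (t i)) / w i
  have hlo : ∀ s (i : Fin n), 0 ≤ min s (t (i + 1)) - min s (t i) := fun s i =>
    sub_nonneg.2 (min_le_min_left s (by linarith [hts i, hw i]))
  have hhi : ∀ s (i : Fin n), min s (t (i + 1)) - min s (t i) ≤ w i := fun s i => by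
    rw [hts, sub_le_iff_le_add, ← min_add_add_left, add_comm (w i) (t i)]
    exact min_le_min_right _ (by linarith [hw i])
  have hmul : ∀ s i, w i * φ s i = min s (t (i + 1)) - min s (t i) := fun s i => by
    rcases (hw i).eq_or_lt with h0 | h0
    · rw [hts, ← h0]; simp
    · exact mul_div_cancel₀ _ h0.ne'
  have hpartial : ∀ s, 0 ≤ s → ∀ m ≤ n,
      ∑ i ∈ Finset.univ.filter (fun i : Fin n => (i : ℕ) < m), w i * φ s i = min s (t m) := by
    intro s hs m hm
    simp_rw [hmul]
    rw [sum_filter_lt_sub (fun m => min s (t m)) hm, ht0, min_eq_right hs, sub_zero]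
  refine ⟨φ, ⟨by fun_prop, fun s _ i => ⟨div_nonneg (hlo s i) (hw i),
    div_le_one_of_le₀ (hhi s i) (hw i)⟩, fun s hs => ?_⟩, hpartial⟩
  have := hpartial s hs.1 n le_rfl
  simpa [htn, hs.2] using this

/-- Every law that satisfies the stop-loss constraints is that of the weighted average of a vector
that satisfies the equal-cost constraints. -/
lemma IsStopLossInput.exists_isECInput {v α : Fin n → ℝ} (hv : ∀ i, 0 ≤ v i)
    (hL : 0 < ∑ i, v i) (hα : ∀ k, α k ∈ Set.Icc (0 : ℝ) 1) (hα_anti : Antitone α)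
    {Q : Measure ℝ} (h : IsStopLossInput v α Q) :
    ∃ P, IsECInput α P ∧ P.map (fun x => (∑ i, v i * x i) / ∑ i, v i) = Q := by
  have := h.isProbabilityMeasure
  set w : Fin n → ℝ := fun i => v i / ∑ j, v j with hwdef
  have hw : ∀ i, 0 ≤ w i := fun i => div_nonneg (hv i) hL.le
  have hw1 : ∑ i, w i = 1 := by rw [hwdef, ← Finset.sum_div, div_self hL.ne']
  have hwsum : ∀ (s : Finset (Fin n)) (a : Fin n → ℝ),
      ∑ i ∈ s, w i * a i = (1 / ∑ i, v i) * ∑ i ∈ s, v i * a i := fun s a => by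
    rw [Finset.mul_sum]
    exact Finset.sum_congr rfl fun i _ => by rw [hwdef]; ring
  have hid : Integrable (fun s : ℝ => s) Q :=
    Integrable.of_mem_Icc 0 1 measurable_id.aemeasurable h.support
  obtain ⟨φ, hφ, hφs⟩ := exists_greedy_allocation hw hw1
  have hmean : ∀ ψ, IsAllocation w ψ → ∀ s : Finset (Fin n),
      ∑ i ∈ s, w i * ∫ x, ψ x i ∂Q = ∫ x, ∑ i ∈ s, w i * ψ x i ∂Q := fun ψ hψ s => by
    rw [integral_finsetSum _ fun i _ => (hψ.integrable h.support i).const_mul _]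
    simp_rw [integral_const_mul]
  have htotal : ∑ i, w i * ∫ x, φ x i ∂Q = ∑ i, w i * α i := by
    rw [hmean φ hφ, hwsum, ← h.mean]
    exact integral_congr_ae (h.support.mono fun s hs => hφ.sum_mul s hs)
  obtain ⟨β, ⟨ψ, hψ, rfl⟩, hβ⟩ := exists_eq_of_weighted_majorization hw hα_anti
    -- The mean vectors of allocations are closed under transfers, because a transfer is linear and
    -- commutes with the integral.
    (𝓑 := {β | ∃ ψ, IsAllocation w ψ ∧ (fun i => ∫ s, ψ s i ∂Q) = β}) (by
      rintro _ ⟨ψ, hψ, rfl⟩ j k θ hjk hθ hj hk hθj hθk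
      refine ⟨_, hψ.transfer hjk hθ hj hk hθj hθk, ?_⟩
      have hi := hψ.integrable h.support
      have hd (r : ℝ) : Integrable (fun s => r * (ψ s j - ψ s k)) Q :=
        ((hi j).sub (hi k)).const_mul r
      ext i
      simp only [weightedTransfer]
      rw [← integral_sub (hi j) (hi k), ← integral_const_mul, ← integral_const_mul]
      split_ifs
      · rename_i hik hij
        exact absurd (hij.symm.trans hik) hjk
      · simp only [sub_zero]
        rw [integral_add (hi i) (hd _)]
      · simp only [add_zero]
        rw [integral_sub (hi i) (hd _)]
      · simp)
    _ ⟨φ, hφ, rfl⟩ htotal (by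
      intro m
      rcases Nat.eq_zero_or_pos m with rfl | hm0
      · simp
      rcases le_or_gt n m with hnm | hmn
      · have : Finset.univ.filter (fun i : Fin n => (i : ℕ) < m) = Finset.univ :=
          Finset.filter_true_of_mem fun i _ => i.2.trans_le hnm
        rw [this]
        exact htotal.ge
      rw [hmean φ hφ]
      set t := ∑ i ∈ Finset.univ.filter (fun i : Fin n => (i : ℕ) < m), w i with ht
      -- The identity min s t = s - (s - t)₊ turns the stop-loss bound into partial-sum domination.
      have h1 : ∫ s, ∑ i ∈ Finset.univ.filter (fun i : Fin n => (i : ℕ) < m), w i * φ s i ∂Q =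
          ∫ s, (s - max (s - t) 0) ∂Q := by
        refine integral_congr_ae (h.support.mono fun s hs => ?_)
        simp only
        rw [hφs s hs.1 m hmn.le, ← ht]
        rcases le_total s t with hst | hst
        · rw [min_eq_left hst, max_eq_right (by linarith), sub_zero]
        · rw [min_eq_right hst, max_eq_left (by linarith)]; ring
      have hmax : Integrable (fun s : ℝ => max (s - t) 0) Q :=
        (hid.sub (integrable_const t)).pos_part
      have h2 := h.stopLoss m hm0 hmn
      rw [h1, integral_sub hid hmax, h.mean, ← hwsum,
        ← sum_filter_lt_add_sum_filter_le (fun i => w i * α i) m]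
      rw [← hwsum] at h2
      linarith)
  -- Majorization leaves zero-weight coordinates uncontrolled; they do not affect the average, so
  -- they are set to their required means.
  let X : ℝ → Fin n → ℝ := fun s i => if 0 < w i then ψ s i else α i
  have hXm : Measurable X := measurable_pi_iff.2 fun i => by
    have := hψ.measurable
    simp only [X]
    split_ifs <;> fun_prop
  have hX : ∀ s ∈ Set.Icc (0 : ℝ) 1, ∀ i, X s i ∈ Set.Icc (0 : ℝ) 1 := fun s hs i => by
    simp only [X]
    split_ifs
    exacts [hψ.mem_Icc s hs i, hα i]
  have hXs : ∀ s ∈ Set.Icc (0 : ℝ) 1, (∑ i, v i * X s i) / ∑ i, v i = s := fun s hs => by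
    rw [div_eq_inv_mul, ← one_div, ← hwsum]
    refine Eq.trans (Finset.sum_congr rfl fun i _ => ?_) (hψ.sum_mul s hs)
    rcases (hw i).eq_or_lt with h0 | h0
    · simp [← h0]
    · simp [X, h0]
  refine ⟨Q.map X, ⟨Measure.isProbabilityMeasure_map hXm.aemeasurable, ?_, fun k => ?_,
    fun k => ?_⟩, ?_⟩
  · refine (ae_map_iff hXm.aemeasurable ?_).2 (h.support.mono fun s hs k => (hX s hs k).1)
    simp only [Set.ofPred_forall]
    exact MeasurableSet.iInter fun k => measurableSet_le measurable_const (measurable_pi_apply k)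
  · have h1 : ∀ᵐ x ∂(Q.map X), ¬ 1 < x k := by
      refine (ae_map_iff hXm.aemeasurable ?_).2 (h.support.mono fun s hs => (hX s hs k).2.not_gt)
      exact (measurableSet_lt measurable_const (measurable_pi_apply k)).compl
    simpa [ae_iff] using h1
  · rw [integral_map hXm.aemeasurable (measurable_pi_apply k).aestronglyMeasurable]
    by_cases hk : 0 < w k
    · simpa [X, hk] using hβ k hk
    · simp [X, hk]
  · rw [Measure.map_map (by fun_prop) hXm]
    conv_rhs => rw [← Measure.map_id (μ := Q)]
    exact Measure.map_congr (h.support.mono fun s hs => hXs s hs)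

end StopLoss

theorem corollary1 {nr nt : ℕ} (hnr : 1 ≤ nr) (hnt : 2 ≤ nt)
    (H : Matrix (Fin nr) (Fin nt) ℝ) (hH : ∀ i j, 0 ≤ H i j) (hrank : H.rank = 1)
    (α : Fin nt → ℝ) (hα : ∀ k, α k ∈ Set.Icc (0 : ℝ) 1) (hα_anti : Antitone α)
    (σ : ℝ) (hσ : 0 < σ)
    (U : Matrix (Fin nr) (Fin nr) ℝ) (B : Matrix (Fin nr) (Fin nt) ℝ)
    (V : Matrix (Fin nt) (Fin nt) ℝ) (hSVD : IsSVD H U B V)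
    (σ₁ : ℝ) (hσ₁ : σ₁ = B ⟨0, by omega⟩ ⟨0, by omega⟩)
    (v₁ : Fin nt → ℝ) (hv₁ : ∀ i, v₁ i = V i ⟨0, by omega⟩) (hv₁_pos : 0 < ∑ i, v₁ i) :
    capacityEC H α σ =
      ⨆ (P : Measure ℝ) (_ : IsStopLossInput v₁ α P),
        mutualInfo (P.prod (gaussianReal 0 (σ ^ 2).toNNReal)) (fun ω => ω.1)
          (fun ω => ω.1 + ω.2 / (σ₁ * ∑ i, v₁ i)) := by
  obtain ⟨m, rfl⟩ : ∃ m, nr = m + 1 := ⟨nr - 1, by omega⟩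
  obtain ⟨n, rfl⟩ : ∃ n, nt = n + 1 := ⟨nt - 1, by omega⟩
  obtain rfl : v₁ = fun i => V i 0 := funext hv₁
  subst hσ₁
  have hB : 0 < B 0 0 := hSVD.pos 0 0 rfl (by simp [hrank])
  have hv := hSVD.right_nonneg_of_rank_one hrank hH hv₁_pos
  have hI (P : Measure (Fin (n + 1) → ℝ)) [IsProbabilityMeasure P] :=
    mutualInfo_rank_one hSVD.left_orthogonal hB.ne' hv₁_pos.ne'
      (hSVD.apply_of_rank_one hrank) σ P
  refine le_antisymm (iSup₂_le fun P hP => ?_) (iSup₂_le fun Q hQ => ?_)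
  · have := hP.isProbabilityMeasure
    rw [hI P]
    exact le_iSup₂_of_le _ (hP.isStopLossInput_map hv hv₁_pos) le_rfl
  · obtain ⟨P, hP, rfl⟩ := hQ.exists_isECInput hv hv₁_pos hα hα_anti
    have := hP.isProbabilityMeasure
    exact le_iSup₂_of_le P hP (hI P).ge
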